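/- Let $d\ge 3$ and let $f:[0,\infty)\to\mathbb R$ be any increasing (i.e. non-decreasing) unbounded function. Then there is a sequence of pairwise disjoint closed balls $\overline B(c_n,r_n)\subset\mathbb R^d$, $n\ge 1$, with $r_n>0$, none of which contains the origin, such that 1. (separated) there is $\epsilon>0$ with $|c_n-c_m|\ge 2\epsilon$ for all $n\ne m$; 2. (avoidable) with positive probability, Brownian motion in $\mathbb R^d$ started at $0$ never hits any of the balls; 3. $r_n^{d-2}|c_n|^2\le f(|c_n|)$ for every $n\ge 1$; 4. $\displaystyle\sum_{n=1}^\infty\left(\frac{r_n}{|c_n|}\right)^{d-2}=\infty$. -/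

import Mathlib

open Set Filter MeasureTheory ProbabilityTheory
open scoped NNReal

universe u

/-- `W` is a standard Brownian motion in `ℝ^d` starting from the origin: its coordinates are
independent real Brownian motions (Mathlib's `IsBrownianReal`, which start at `0` almost surely
and have almost surely continuous paths). -/
structure IsBrownianVec {d : ℕ} {Ω : Type u} [MeasurableSpace Ω]
    (W : ℝ≥0 → Ω → EuclideanSpace ℝ (Fin d)) (P : Measure Ω) : Prop where
  coord : ∀ i : Fin d, IsBrownianReal (fun t ω => W t ω i) P
  indep : iIndepFun (fun (i : Fin d) (ω : Ω) (t : ℝ≥0) => W t ω i) P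

/-- The complement of the union of the closed balls with centres `c n` and radii `r n`. -/
def ballComplement {d : ℕ} (c : ℕ → EuclideanSpace ℝ (Fin d)) (r : ℕ → ℝ) :
    Set (EuclideanSpace ℝ (Fin d)) :=
  (⋃ n, Metric.closedBall (c n) (r n))ᶜ

/-- A countably infinite collection of non-overlapping closed balls of positive radius, none of
which contains the origin. -/
structure IsBallCollection {d : ℕ} (c : ℕ → EuclideanSpace ℝ (Fin d)) (r : ℕ → ℝ) : Prop where
  radius_pos : ∀ n, 0 < r n
  disjoint : Pairwise fun n m =>
    Disjoint (Metric.closedBall (c n) (r n)) (Metric.closedBall (c m) (r m))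
  zero_mem : (0 : EuclideanSpace ℝ (Fin d)) ∈ ballComplement c r

/-- The centres are uniformly separated. -/
def IsSeparatedCollection {d : ℕ} (c : ℕ → EuclideanSpace ℝ (Fin d)) : Prop :=
  ∃ ε : ℝ, 0 < ε ∧ ∀ n m, n ≠ m → 2 * ε ≤ ‖c n - c m‖

/-- The collection is avoidable: Brownian motion starting from the origin has positive
probability of never hitting any of the balls. This probability depends only on the law of
Brownian motion, so the requirement is made for every realization `W` of Brownian motion on a
probability space. -/
def IsAvoidable {d : ℕ} (c : ℕ → EuclideanSpace ℝ (Fin d)) (r : ℕ → ℝ) : Prop :=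
  ∀ (Ω : Type u) [MeasurableSpace Ω] (P : Measure Ω) [IsProbabilityMeasure P]
    (W : ℝ≥0 → Ω → EuclideanSpace ℝ (Fin d)), IsBrownianVec W P →
    0 < P {ω | ∀ t : ℝ≥0, W t ω ∈ ballComplement c r}

/-!
For `3 ≤ d` the Green function `∫ (2πs)^(-d/2) exp(-r²/2s) ds` of Brownian motion is a finite
multiple of `r ^ (2 - d)`, and averaging it against a Gaussian only removes an initial part of the
time integral, so it decreases along Brownian motion in the mean. The maximal inequality for this
supermartingale, sampled at finitely many times and then passed to the limit by path continuity,
shows that Brownian motion hits a ball of radius `ρ` around `x` with probability at most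
`(ρ / ‖x‖) ^ (d - 2)`.

The balls are placed in cubes of `M ^ d` lattice points at distance `C * M` from the origin, where
`C` grows geometrically from one cube to the next. Hitting one of the small balls in a cube requires
hitting a single large ball around the cube, and the probabilities of the latter events have sum
less than one whatever the side lengths are. With radii `s` such that `s ^ (d - 2)` is
`(2 * C) ^ (d - 2) / M ^ 2`, every cube contributes at least one to the series, while
`s ^ (d - 2) * ‖c‖ ^ 2` is at most `(2 * C) ^ d`. This bound does not involve `M`, so it lies below
`f` once `M` is large.
-/

section GaussianConvolution

lemma gaussianPDFReal_add_mul {s t : ℝ≥0} (hs : s ≠ 0) (ht : t ≠ 0) (y z : ℝ) :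
    gaussianPDFReal 0 s (y + z) * gaussianPDFReal 0 t z =
      gaussianPDFReal 0 (s + t) y * gaussianPDFReal (-(y * t / (s + t))) (s * t / (s + t)) z := by
  have : (0 : ℝ) < s := by positivity
  have : (0 : ℝ) < t := by positivity
  simp only [gaussianPDFReal]
  rw [mul_mul_mul_comm, mul_mul_mul_comm (√(2 * Real.pi * ↑(s + t)))⁻¹, ← Real.exp_add,
    ← Real.exp_add, ← mul_inv, ← mul_inv, ← Real.sqrt_mul (by positivity),
    ← Real.sqrt_mul (by positivity)]
  congr 1
  · congr 2
    push_cast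
    field_simp
  · congr 1
    push_cast
    field_simp
    ring

lemma lintegral_gaussianPDF_add {s : ℝ≥0} (hs : s ≠ 0) (t : ℝ≥0) (y : ℝ) :
    ∫⁻ z, gaussianPDF 0 s (y + z) ∂gaussianReal 0 t = gaussianPDF 0 (s + t) y := by
  have hmeas : Measurable fun z => gaussianPDF 0 s (y + z) :=
    (measurable_gaussianPDF _ _).comp (measurable_const_add y)
  obtain rfl | ht := eq_or_ne t 0
  · simp [gaussianReal_zero_var, lintegral_dirac' _ hmeas]
  have hsplit : ∀ z, gaussianPDF 0 t z * gaussianPDF 0 s (y + z) =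
      gaussianPDF 0 (s + t) y * gaussianPDF (-(y * t / (s + t))) (s * t / (s + t)) z := by
    intro z
    simp only [gaussianPDF]
    rw [← ENNReal.ofReal_mul (gaussianPDFReal_nonneg _ _ _),
      ← ENNReal.ofReal_mul (gaussianPDFReal_nonneg _ _ _), mul_comm,
      gaussianPDFReal_add_mul hs ht]
  rw [gaussianReal_of_var_ne_zero _ ht,
    lintegral_withDensity_eq_lintegral_mul _ (measurable_gaussianPDF _ _) hmeas]
  simp only [Pi.mul_apply, hsplit]
  rw [lintegral_const_mul _ (measurable_gaussianPDF _ _),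
    lintegral_gaussianPDF_eq_one _ (by positivity), mul_one]

end GaussianConvolution

section GreenFunction

/-- The transition density of Brownian motion in dimension `d` after time `s`, as a function of the
distance `r` between the two points. -/
noncomputable def heatKernel (d : ℕ) (s r : ℝ) : ℝ :=
  (√(2 * Real.pi * s))⁻¹ ^ d * Real.exp (-r ^ 2 / (2 * s))

/-- The Green function of Brownian motion in dimension `d`, as a function of the distance `r`
between the two points. It is encoded as the time integral of the heat kernel, which makes its
superharmonicity immediate; for `3 ≤ d` it is a multiple of `r ^ (2 - d)`. -/
noncomputable def greenFunction (d : ℕ) (r : ℝ) : ENNReal :=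
  ∫⁻ s in Ioi (0 : ℝ), ENNReal.ofReal (heatKernel d s r)

@[fun_prop]
lemma measurable_heatKernel (d : ℕ) : Measurable fun p : ℝ × ℝ => heatKernel d p.1 p.2 := by
  unfold heatKernel
  fun_prop

lemma heatKernel_pos (d : ℕ) {s : ℝ} (hs : 0 < s) (r : ℝ) : 0 < heatKernel d s r := by
  unfold heatKernel
  positivity

lemma heatKernel_sq_mul_mul (d : ℕ) {a : ℝ} (ha : 0 < a) (s r : ℝ) :
    heatKernel d (a ^ 2 * s) (a * r) = a⁻¹ ^ d * heatKernel d s r := by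
  have hsqrt : √(2 * Real.pi * (a ^ 2 * s)) = a * √(2 * Real.pi * s) := by
    rw [mul_left_comm, Real.sqrt_mul (sq_nonneg a), Real.sqrt_sq ha.le]
  have hexp : -(a * r) ^ 2 / (2 * (a ^ 2 * s)) = -r ^ 2 / (2 * s) := by
    rw [mul_pow, ← mul_neg, mul_left_comm, mul_div_mul_left _ _ (by positivity)]
  rw [heatKernel, heatKernel, hsqrt, hexp, mul_inv, mul_pow, mul_assoc]

lemma measurable_greenFunction (d : ℕ) : Measurable (greenFunction d) :=
  Measurable.lintegral_prod_left' (measurable_heatKernel d).ennreal_ofReal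

lemma greenFunction_antitoneOn (d : ℕ) : AntitoneOn (greenFunction d) (Ici 0) := by
  intro r hr r' _ hrr'
  refine setLIntegral_mono' measurableSet_Ioi fun s hs => ENNReal.ofReal_le_ofReal ?_
  have hs : 0 < s := hs
  have hr : 0 ≤ r := hr
  unfold heatKernel
  gcongr

lemma greenFunction_pos (d : ℕ) (r : ℝ) : 0 < greenFunction d r := by
  have hmeas : Measurable fun s => heatKernel d s r := by fun_prop
  have hsupp : Ioi 0 ⊆ Function.support fun s => ENNReal.ofReal (heatKernel d s r) :=
    fun s hs => (ENNReal.ofReal_pos.2 (heatKernel_pos d hs r)).ne'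
  rw [greenFunction, setLIntegral_pos_iff hmeas.ennreal_ofReal, inter_eq_right.2 hsupp]
  simp

lemma greenFunction_mul {d : ℕ} (hd : 2 ≤ d) {a : ℝ} (ha : 0 < a) (r : ℝ) :
    greenFunction d (a * r) = ENNReal.ofReal (a⁻¹ ^ (d - 2)) * greenFunction d r := by
  have himage : (fun s => a ^ 2 * s) '' Ioi 0 = Ioi 0 := by
    simpa using image_mul_left_Ioi (pow_pos ha 2) 0
  have hderiv : ∀ s ∈ Ioi (0 : ℝ), HasDerivWithinAt (fun s => a ^ 2 * s) (a ^ 2) (Ioi 0) s :=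
    fun s _ => by simpa using (hasDerivWithinAt_id s (Ioi 0)).const_mul (a ^ 2)
  have hinj : InjOn (fun s => a ^ 2 * s) (Ioi 0) :=
    (mul_right_injective₀ (pow_pos ha 2).ne').injOn
  have hpow : a ^ 2 * a⁻¹ ^ d = a⁻¹ ^ (d - 2) := by
    obtain ⟨k, rfl⟩ := Nat.exists_eq_add_of_le hd
    rw [pow_add, ← mul_assoc, ← mul_pow, mul_inv_cancel₀ ha.ne', one_pow, one_mul,
      Nat.add_sub_cancel_left]
  have hmeas : Measurable fun s => heatKernel d s r := by fun_prop
  calc greenFunction d (a * r)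
      = ∫⁻ s in (fun s => a ^ 2 * s) '' Ioi 0, ENNReal.ofReal (heatKernel d s (a * r)) := by
        rw [himage, greenFunction]
    _ = ∫⁻ s in Ioi 0, ENNReal.ofReal (a⁻¹ ^ (d - 2)) * ENNReal.ofReal (heatKernel d s r) := by
        rw [lintegral_image_eq_lintegral_abs_deriv_mul measurableSet_Ioi hderiv hinj]
        refine lintegral_congr fun s => ?_
        rw [abs_of_nonneg (sq_nonneg a), heatKernel_sq_mul_mul d ha,
          ← ENNReal.ofReal_mul (sq_nonneg a), ← mul_assoc, hpow, ENNReal.ofReal_mul (by positivity)]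
    _ = _ := lintegral_const_mul _ hmeas.ennreal_ofReal

lemma integrableOn_rpow_neg_mul_exp_neg_div {a b : ℝ} (ha : 1 < a) (hb : 0 < b) :
    IntegrableOn (fun s : ℝ => s ^ (-a) * Real.exp (-b / s)) (Ioi 0) := by
  have hgamma : IntegrableOn (fun u : ℝ => u ^ (a - 2) * Real.exp (-b * u ^ (1 : ℝ))) (Ioi 0) :=
    integrableOn_rpow_mul_exp_neg_mul_rpow (by linarith) one_pos hb
  rw [← integrableOn_Ioi_comp_rpow_iff' _ (p := -1) (by norm_num)] at hgamma
  refine hgamma.congr_fun (fun s hs => ?_) measurableSet_Ioi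
  have hs : 0 < s := hs
  have hpow : s ^ (-1 - 1 : ℝ) * (s ^ (-1 : ℝ)) ^ (a - 2) = s ^ (-a) := by
    rw [← Real.rpow_mul hs.le, ← Real.rpow_add hs]
    ring_nf
  simp only [smul_eq_mul, Real.rpow_one]
  rw [← mul_assoc, hpow, Real.rpow_neg_one, div_eq_mul_inv]

lemma heatKernel_eq_rpow_mul_exp (d : ℕ) {s : ℝ} (hs : 0 < s) (r : ℝ) :
    heatKernel d s r =
      (√(2 * Real.pi))⁻¹ ^ d * (s ^ (-(d / 2 : ℝ)) * Real.exp (-(r ^ 2 / 2) / s)) := by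
  have hpow : (√s)⁻¹ ^ d = s ^ (-(d / 2 : ℝ)) := by
    rw [Real.sqrt_eq_rpow, ← Real.rpow_neg hs.le, ← Real.rpow_natCast, ← Real.rpow_mul hs.le]
    ring_nf
  have hexp : -(r ^ 2 / 2) / s = -r ^ 2 / (2 * s) := by ring
  rw [heatKernel, Real.sqrt_mul (by positivity), mul_inv, mul_pow, hpow, hexp, mul_assoc]

lemma greenFunction_ne_top {d : ℕ} (hd : 3 ≤ d) {r : ℝ} (hr : 0 < r) : greenFunction d r ≠ ⊤ := by
  have hd' : (3 : ℝ) ≤ d := by exact_mod_cast hd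
  have hint : IntegrableOn (fun s => heatKernel d s r) (Ioi 0) :=
    IntegrableOn.congr_fun ((integrableOn_rpow_neg_mul_exp_neg_div (a := d / 2) (b := r ^ 2 / 2)
      (by linarith) (by positivity)).const_mul _)
      (fun s hs => (heatKernel_eq_rpow_mul_exp d hs r).symm) measurableSet_Ioi
  exact hint.lintegral_lt_top.ne

lemma ofReal_heatKernel_norm {d : ℕ} {s : ℝ} (hs : 0 ≤ s) (y : Fin d → ℝ) :
    ENNReal.ofReal (heatKernel d s ‖WithLp.toLp 2 y‖) = ∏ i, gaussianPDF 0 s.toNNReal (y i) := by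
  simp only [gaussianPDF]
  rw [← ENNReal.ofReal_prod_of_nonneg fun i _ => gaussianPDFReal_nonneg _ _ _]
  simp only [gaussianPDFReal, heatKernel, Real.coe_toNNReal s hs, sub_zero,
    EuclideanSpace.real_norm_sq_eq]
  rw [Finset.prod_mul_distrib, ← Real.exp_sum]
  simp [← Finset.sum_div]

lemma lintegral_heatKernel_add {d : ℕ} {s : ℝ} (hs : 0 < s) (v : ℝ≥0) (y : Fin d → ℝ) :
    ∫⁻ x, ENNReal.ofReal (heatKernel d s ‖WithLp.toLp 2 (y + x)‖)
        ∂(Measure.pi fun _ => gaussianReal 0 v) =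
      ENNReal.ofReal (heatKernel d (s + v) ‖WithLp.toLp 2 y‖) := by
  have hmeas : ∀ i, Measurable fun x => gaussianPDF 0 s.toNNReal (y i + x) := fun i =>
    (measurable_gaussianPDF _ _).comp (measurable_const_add (y i))
  simp_rw [ofReal_heatKernel_norm hs.le, ofReal_heatKernel_norm (add_nonneg hs.le v.coe_nonneg),
    Pi.add_apply]
  rw [lintegral_prod_eq_prod_lintegral_of_indepFun Finset.univ
    (fun i (x : Fin d → ℝ) => gaussianPDF 0 s.toNNReal (y i + x i))
    (iIndepFun_pi fun i => (hmeas i).aemeasurable) fun i => (hmeas i).comp (measurable_pi_apply i)]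
  refine Finset.prod_congr rfl fun i _ => ?_
  rw [(measurePreserving_eval (fun _ => gaussianReal 0 v) i).lintegral_comp (hmeas i),
    lintegral_gaussianPDF_add (by simpa using hs), Real.toNNReal_add hs.le v.coe_nonneg,
    Real.toNNReal_coe]

-- Averaging against a Gaussian of variance `v` discards the time interval `(0, v]`.
lemma lintegral_greenFunction_add_le {d : ℕ} (v : ℝ≥0) (y : Fin d → ℝ) :
    ∫⁻ x, greenFunction d ‖WithLp.toLp 2 (y + x)‖ ∂(Measure.pi fun _ => gaussianReal 0 v) ≤
      greenFunction d ‖WithLp.toLp 2 y‖ := by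
  have hmeas : Measurable fun s => ENNReal.ofReal (heatKernel d s ‖WithLp.toLp 2 y‖) := by fun_prop
  calc ∫⁻ x, greenFunction d ‖WithLp.toLp 2 (y + x)‖ ∂(Measure.pi fun _ => gaussianReal 0 v)
      = ∫⁻ s in Ioi (0 : ℝ), ENNReal.ofReal (heatKernel d (s + v) ‖WithLp.toLp 2 y‖) := by
        simp only [greenFunction]
        rw [lintegral_lintegral_swap (by fun_prop)]
        exact setLIntegral_congr_fun measurableSet_Ioi fun s hs => lintegral_heatKernel_add hs v y
    _ = ∫⁻ s in Ioi (v : ℝ), ENNReal.ofReal (heatKernel d s ‖WithLp.toLp 2 y‖) := by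
        rw [← (measurePreserving_add_right volume (v : ℝ)).setLIntegral_comp_preimage
          measurableSet_Ioi hmeas]
        simp
    _ ≤ _ := lintegral_mono_set (Ioi_subset_Ioi v.coe_nonneg)

end GreenFunction

section MaximalInequality

variable {E : Type*} [AddMonoid E] [MeasurableSpace E] [MeasurableAdd₂ E] {u : E → ENNReal}

lemma measurable_partialSum {n : ℕ} (k : Fin (n + 1)) :
    Measurable fun x : Fin n → E => Fin.partialSum x k := by
  induction k using Fin.induction with
  | zero => simp only [Fin.partialSum_zero, measurable_const]
  | succ k ih => simp only [Fin.partialSum_succ]; fun_prop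

lemma measurableSet_exists_le_comp_add_partialSum (hu : Measurable u) (a : ENNReal) (n : ℕ) :
    MeasurableSet {p : E × (Fin n → E) | ∃ k, a ≤ u (p.1 + Fin.partialSum p.2 k)} := by
  rw [ofPred_exists]
  exact MeasurableSet.iUnion fun k => measurableSet_le measurable_const <|
    hu.comp <| measurable_fst.add <| (measurable_partialSum k).comp measurable_snd

lemma measure_pi_exists_le_comp_add_partialSum_succ (hu : Measurable u) {a : ENNReal} {n : ℕ}
    (ν : Fin (n + 1) → Measure E) [∀ k, SigmaFinite (ν k)] {y : E} (hy : ¬ a ≤ u y) :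
    Measure.pi ν {x | ∃ k, a ≤ u (y + Fin.partialSum x k)} =
      ∫⁻ z, Measure.pi (Fin.tail ν) {x | ∃ k, a ≤ u (y + z + Fin.partialSum x k)} ∂ν 0 := by
  have : ∀ k, SigmaFinite (Fin.tail ν k) := fun k => inferInstanceAs (SigmaFinite (ν k.succ))
  let A : Set (E × (Fin n → E)) := {p | ∃ k, a ≤ u (y + p.1 + Fin.partialSum p.2 k)}
  have hA : MeasurableSet A :=
    (measurable_fst.const_add y).prodMk measurable_snd
      (measurableSet_exists_le_comp_add_partialSum hu a n)
  have hpre : {x : Fin (n + 1) → E | ∃ k, a ≤ u (y + Fin.partialSum x k)} =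
      MeasurableEquiv.piFinSuccAbove (fun _ => E) 0 ⁻¹' A := by
    ext x
    rw [mem_ofPred_eq, Fin.exists_fin_succ, Fin.partialSum_zero, add_zero, or_iff_right hy]
    simp_rw [Fin.partialSum_succ', ← add_assoc]
    rfl
  rw [hpre, (measurePreserving_piFinSuccAbove ν 0).measure_preimage hA.nullMeasurableSet,
    Measure.prod_apply hA]
  rfl

-- Ville's inequality for the supermartingale `u (y + x₀ + ⋯ + xₖ₋₁)`, by conditioning on `x₀`.
lemma mul_measure_exists_le_comp_add_partialSum_le (hu : Measurable u) (a : ENNReal) {n : ℕ}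
    (ν : Fin n → Measure E) [∀ k, IsProbabilityMeasure (ν k)]
    (hν : ∀ k y, ∫⁻ x, u (y + x) ∂ν k ≤ u y) (y : E) :
    a * Measure.pi ν {x | ∃ k, a ≤ u (y + Fin.partialSum x k)} ≤ u y := by
  by_cases hy : a ≤ u y
  · exact (mul_le_of_le_one_right zero_le prob_le_one).trans hy
  induction n generalizing y with
  | zero => simp [Fin.exists_fin_one, hy]
  | succ n ih =>
    have : ∀ k, IsProbabilityMeasure (Fin.tail ν k) := fun k =>
      inferInstanceAs (IsProbabilityMeasure (ν k.succ))
    have hstep : ∀ z, a * Measure.pi (Fin.tail ν)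
        {x | ∃ k, a ≤ u (y + z + Fin.partialSum x k)} ≤ u (y + z) := by
      intro z
      by_cases hz : a ≤ u (y + z)
      · exact (mul_le_of_le_one_right zero_le prob_le_one).trans hz
      · exact ih (Fin.tail ν) (fun k => hν k.succ) (y + z) hz
    rw [measure_pi_exists_le_comp_add_partialSum_succ hu ν hy, ← lintegral_const_mul]
    · exact (lintegral_mono hstep).trans (hν 0 y)
    · exact (measurable_measure_prodMk_left
        (measurableSet_exists_le_comp_add_partialSum hu a n)).comp (measurable_const_add y)

end MaximalInequality

section HittingProbability

lemma measurePreserving_swap_pi {ι κ X : Type*} [Fintype ι] [Fintype κ] [MeasurableSpace X]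
    (μ : ι → κ → Measure X) [∀ i k, IsProbabilityMeasure (μ i k)] :
    MeasurePreserving Function.swap (Measure.pi fun i => Measure.pi fun k => μ i k)
      (Measure.pi fun k => Measure.pi fun i => μ i k) := by
  have hswap : (Function.swap : (ι → κ → X) → κ → ι → X) =
      MeasurableEquiv.curry κ ι X ∘ MeasurableEquiv.piCongrLeft (fun _ => X) (Equiv.prodComm ι κ) ∘
        (MeasurableEquiv.curry ι κ X).symm := by
    ext x k i
    exact (Equiv.piCongrLeft_apply_apply (fun _ => X) (Equiv.prodComm ι κ)
      (fun p : ι × κ => x p.1 p.2) (i, k)).symm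
  have hmap : Measure.map (MeasurableEquiv.piCongrLeft (fun _ => X) (Equiv.prodComm ι κ))
      (Measure.infinitePi fun p : ι × κ => μ p.1 p.2) =
        Measure.infinitePi fun p : κ × ι => μ p.2 p.1 :=
    Measure.infinitePi_map_piCongrLeft (fun p : κ × ι => μ p.2 p.1) (Equiv.prodComm ι κ)
  refine ⟨by rw [hswap]; fun_prop, ?_⟩
  rw [hswap, ← Measure.map_map (by fun_prop) (by fun_prop),
    ← Measure.map_map (by fun_prop) (by fun_prop)]
  simp_rw [← Measure.infinitePi_eq_pi]
  rw [Measure.infinitePi_map_curry_symm, hmap, Measure.infinitePi_map_curry fun k i => μ i k]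

namespace IsBrownianVec

variable {d : ℕ} {Ω : Type*} [MeasurableSpace Ω] {P : Measure Ω}
  {W : ℝ≥0 → Ω → EuclideanSpace ℝ (Fin d)}

lemma hasLaw_increments (hW : IsBrownianVec W P) {n : ℕ} {t : Fin (n + 1) → ℝ≥0}
    (ht : Monotone t) :
    HasLaw (fun ω (k : Fin n) i => W (t k.succ) ω i - W (t k.castSucc) ω i)
      (Measure.pi fun k => Measure.pi fun _ : Fin d =>
        gaussianReal 0 (t k.succ - t k.castSucc)) P := by
  have hdist : ∀ k : Fin n, nndist (t k.succ : ℝ) (t k.castSucc) = t k.succ - t k.castSucc := by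
    intro k
    have hle : t k.castSucc ≤ t k.succ := ht k.castSucc_le_succ
    ext
    rw [coe_nndist, Real.dist_eq, NNReal.coe_sub hle, abs_of_nonneg (by simpa using hle)]
  have hcoord : ∀ i, HasLaw (fun ω (k : Fin n) => W (t k.succ) ω i - W (t k.castSucc) ω i)
      (Measure.pi fun k => gaussianReal 0 (t k.succ - t k.castSucc)) P := fun i =>
    ((hW.coord i).hasIndepIncrements n t ht).hasLaw_pi fun k =>
      hdist k ▸ (hW.coord i).hasLaw_sub (t k.succ) (t k.castSucc)
  have hindep : iIndepFun (fun i ω (k : Fin n) => W (t k.succ) ω i - W (t k.castSucc) ω i) P :=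
    hW.indep.comp (fun _ (w : ℝ≥0 → ℝ) (k : Fin n) => w (t k.succ) - w (t k.castSucc))
      fun _ => by fun_prop
  exact (measurePreserving_swap_pi fun _ k => gaussianReal 0 (t k.succ - t k.castSucc)).hasLaw.comp
    (hindep.hasLaw_pi hcoord)

lemma ae_eval_zero (hW : IsBrownianVec W P) : ∀ᵐ ω ∂P, W 0 ω = 0 := by
  filter_upwards [ae_all_iff.2 fun i => (hW.coord i).eval_zero_ae_eq_zero] with ω hω
  exact PiLp.ext hω

lemma ae_continuous (hW : IsBrownianVec W P) : ∀ᵐ ω ∂P, Continuous fun t => W t ω := by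
  filter_upwards [ae_all_iff.2 fun i => (hW.coord i).cont] with ω hω
  exact (PiLp.continuous_toLp 2 _).comp (continuous_pi hω)

lemma greenFunction_mul_measure_exists_fin_le (hW : IsBrownianVec W P) {n : ℕ}
    {t : Fin (n + 1) → ℝ≥0} (ht : Monotone t) (ht0 : t 0 = 0) (x : EuclideanSpace ℝ (Fin d))
    (ρ : ℝ) :
    greenFunction d ρ * P {ω | ∃ k, W (t k) ω ∈ Metric.closedBall x ρ} ≤ greenFunction d ‖x‖ := by
  let u : (Fin d → ℝ) → ENNReal := fun y => greenFunction d ‖WithLp.toLp 2 y‖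
  have hu : Measurable u := (measurable_greenFunction d).comp (by fun_prop)
  let D : Ω → Fin n → Fin d → ℝ := fun ω k i => W (t k.succ) ω i - W (t k.castSucc) ω i
  let ν : Fin n → Measure (Fin d → ℝ) := fun k =>
    Measure.pi fun _ => gaussianReal 0 (t k.succ - t k.castSucc)
  have hsum : ∀ᵐ ω ∂P, ∀ k, WithLp.toLp 2 (Fin.partialSum (D ω) k) = W (t k) ω := by
    filter_upwards [hW.ae_eval_zero] with ω hω k
    induction k using Fin.induction with
    | zero => simp [ht0, hω]
    | succ k ih =>
      rw [Fin.partialSum_succ, WithLp.toLp_add, ih]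
      ext i
      simp [D]
  have hmeas : MeasurableSet
      {z : Fin n → Fin d → ℝ | ∃ k, greenFunction d ρ ≤ u (-x.ofLp + Fin.partialSum z k)} :=
    measurable_prodMk_left (measurableSet_exists_le_comp_add_partialSum hu _ n)
  calc greenFunction d ρ * P {ω | ∃ k, W (t k) ω ∈ Metric.closedBall x ρ}
      ≤ greenFunction d ρ *
          P {ω | ∃ k, greenFunction d ρ ≤ u (-x.ofLp + Fin.partialSum (D ω) k)} := by
        refine mul_le_mul_right (measure_mono_ae ?_) _
        filter_upwards [hsum] with ω hω
        rintro ⟨k, hk⟩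
        rw [mem_closedBall_iff_norm, ← hω k, sub_eq_neg_add] at hk
        exact ⟨k, greenFunction_antitoneOn d (norm_nonneg _) ((norm_nonneg _).trans hk) hk⟩
    _ = greenFunction d ρ *
          Measure.pi ν {z | ∃ k, greenFunction d ρ ≤ u (-x.ofLp + Fin.partialSum z k)} := by
        rw [(hW.hasLaw_increments ht).measure_eq hmeas]
    _ ≤ u (-x.ofLp) := mul_measure_exists_le_comp_add_partialSum_le hu _ ν
        (fun k y => lintegral_greenFunction_add_le _ y) _
    _ = greenFunction d ‖x‖ := by simp [u]

lemma greenFunction_mul_measure_exists_mem_finset_le (hW : IsBrownianVec W P) (T : Finset ℝ≥0)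
    (x : EuclideanSpace ℝ (Fin d)) (ρ : ℝ) :
    greenFunction d ρ * P {ω | ∃ t ∈ T, W t ω ∈ Metric.closedBall x ρ} ≤ greenFunction d ‖x‖ := by
  have hcard : (insert 0 T).card = ((insert 0 T).card - 1) + 1 :=
    (Nat.sub_add_cancel (Finset.insert_nonempty 0 T).card_pos).symm
  let t := (insert 0 T).orderEmbOfFin hcard
  have hrange : range t = insert 0 (T : Set ℝ≥0) := by
    rw [Finset.range_orderEmbOfFin, Finset.coe_insert]
  have ht0 : t 0 = 0 := by
    obtain ⟨k, hk⟩ : 0 ∈ range t := hrange ▸ mem_insert 0 _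
    exact nonpos_iff_eq_zero.1 ((t.monotone (Fin.zero_le k)).trans_eq hk)
  refine (mul_le_mul_right (measure_mono ?_) _).trans
    (hW.greenFunction_mul_measure_exists_fin_le t.monotone ht0 x ρ)
  rintro ω ⟨s, hs, hω⟩
  obtain ⟨k, rfl⟩ : s ∈ range t := hrange ▸ mem_insert_of_mem 0 hs
  exact ⟨k, hω⟩

lemma greenFunction_mul_measure_exists_mem_ball_le (hW : IsBrownianVec W P)
    (x : EuclideanSpace ℝ (Fin d)) (ρ : ℝ) :
    greenFunction d ρ * P {ω | ∃ t, W t ω ∈ Metric.ball x ρ} ≤ greenFunction d ‖x‖ := by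
  let q := TopologicalSpace.denseSeq ℝ≥0
  let A : ℕ → Set Ω := fun n =>
    {ω | ∃ t ∈ (Finset.range n).image q, W t ω ∈ Metric.closedBall x ρ}
  have hA : Monotone A := fun m n hmn ω ⟨t, ht, hω⟩ =>
    ⟨t, Finset.image_subset_image (Finset.range_mono hmn) ht, hω⟩
  have hsub : P {ω | ∃ t, W t ω ∈ Metric.ball x ρ} ≤ P (⋃ n, A n) := by
    refine measure_mono_ae ?_
    filter_upwards [hW.ae_continuous] with ω hω
    rintro ⟨t, ht⟩
    obtain ⟨_, hs, n, rfl⟩ := (TopologicalSpace.denseRange_denseSeq ℝ≥0).inter_open_nonempty _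
      (Metric.isOpen_ball.preimage hω) ⟨t, ht⟩
    exact mem_iUnion.2 ⟨n + 1, q n, Finset.mem_image_of_mem q (Finset.self_mem_range_succ n),
      Metric.ball_subset_closedBall hs⟩
  calc greenFunction d ρ * P {ω | ∃ t, W t ω ∈ Metric.ball x ρ}
      ≤ greenFunction d ρ * P (⋃ n, A n) := by gcongr
    _ = ⨆ n, greenFunction d ρ * P (A n) := by rw [hA.measure_iUnion, ENNReal.mul_iSup]
    _ ≤ greenFunction d ‖x‖ := iSup_le fun n =>
        hW.greenFunction_mul_measure_exists_mem_finset_le _ x ρ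

lemma measure_exists_mem_ball_le (hW : IsBrownianVec W P) (hd : 3 ≤ d)
    {x : EuclideanSpace ℝ (Fin d)} (hx : x ≠ 0) {ρ : ℝ} (hρ : 0 < ρ) :
    P {ω | ∃ t, W t ω ∈ Metric.ball x ρ} ≤ ENNReal.ofReal ((ρ / ‖x‖) ^ (d - 2)) := by
  have : 0 < ‖x‖ := norm_pos_iff.2 hx
  have hscale : greenFunction d ‖x‖ =
      greenFunction d ρ * ENNReal.ofReal ((ρ / ‖x‖) ^ (d - 2)) := by
    rw [← inv_div ‖x‖ ρ, mul_comm, ← greenFunction_mul (by omega) (by positivity),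
      div_mul_cancel₀ _ hρ.ne']
  exact (ENNReal.mul_le_mul_iff_right (greenFunction_pos d ρ).ne' (greenFunction_ne_top hd hρ)).1
    ((hW.greenFunction_mul_measure_exists_mem_ball_le x ρ).trans_eq hscale)

end IsBrownianVec

end HittingProbability

section Avoidance

variable {d : ℕ} {c : ℕ → EuclideanSpace ℝ (Fin d)} {r : ℕ → ℝ}

lemma isBallCollection_of_add_lt_norm_sub (hr : ∀ n, 0 < r n)
    (hdisj : Pairwise fun n m => r n + r m < ‖c n - c m‖) (hzero : ∀ n, r n < ‖c n‖) :
    IsBallCollection c r where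
  radius_pos := hr
  disjoint n m hnm := Metric.closedBall_disjoint_closedBall <| by
    rw [dist_eq_norm]
    exact hdisj hnm
  zero_mem := by
    simpa [ballComplement] using hzero

lemma isAvoidable_of_tsum_lt_one (hd : 3 ≤ d) {ι : Type*} [Countable ι]
    {x : ι → EuclideanSpace ℝ (Fin d)} {ρ : ι → ℝ} (hx : ∀ k, x k ≠ 0) (hρ : ∀ k, 0 < ρ k)
    (hsum : ∑' k, ENNReal.ofReal ((ρ k / ‖x k‖) ^ (d - 2)) < 1)
    (hsub : ∀ n, ∃ k, Metric.closedBall (c n) (r n) ⊆ Metric.ball (x k) (ρ k)) :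
    IsAvoidable.{u} c r := by
  intro Ω _ P _ W hW
  let A : Set Ω := {ω | ∀ t, W t ω ∈ ballComplement c r}
  let B : Set Ω := ⋃ k, {ω | ∃ t, W t ω ∈ Metric.ball (x k) (ρ k)}
  have hcover : univ ⊆ A ∪ B := by
    intro ω _
    by_contra! hω
    obtain ⟨hA, hB⟩ := not_or.1 hω
    simp only [A, B, ballComplement, mem_ofPred_eq, mem_compl_iff, mem_iUnion, not_forall,
      not_not, not_exists] at hA hB
    obtain ⟨t, n, htn⟩ := hA
    obtain ⟨k, hk⟩ := hsub n
    exact hB k t (hk htn)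
  have hB : P B < 1 := by
    calc P B ≤ ∑' k, P {ω | ∃ t, W t ω ∈ Metric.ball (x k) (ρ k)} := measure_iUnion_le _
      _ ≤ ∑' k, ENNReal.ofReal ((ρ k / ‖x k‖) ^ (d - 2)) :=
        ENNReal.tsum_le_tsum fun k => hW.measure_exists_mem_ball_le hd (hx k) (hρ k)
      _ < 1 := hsum
  have hAB : 1 ≤ P A + P B := by
    rw [← measure_univ (μ := P)]
    exact (measure_mono hcover).trans (measure_union_le _ _)
  refine pos_iff_ne_zero.2 fun hA : P A = 0 => hAB.not_gt ?_
  rwa [hA, zero_add]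

end Avoidance

section Convergence

lemma tendsto_atTop_of_monotoneOn_of_not_bddAbove {α β : Type*} [Preorder α]
    [IsDirectedOrder α] [LinearOrder β] {f : α → β} {a : α} (hf : MonotoneOn f (Ici a))
    (hf' : ¬ BddAbove (f '' Ici a)) : Tendsto f atTop atTop := by
  refine tendsto_atTop.2 fun b => ?_
  obtain ⟨_, ⟨x, hx, rfl⟩, hb⟩ := not_bddAbove_iff.1 hf' b
  filter_upwards [eventually_ge_atTop x] with y hxy
  exact hb.le.trans (hf hx (hx.trans hxy) hxy)

lemma tsum_ofReal_one_div_four_pow_succ_lt_one :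
    ∑' k : ℕ, ENNReal.ofReal ((1 / 4) ^ (k + 1)) < 1 := by
  have hgeom : HasSum (fun k : ℕ => (1 / 4 : ℝ) * (1 / 4) ^ k) (1 / 4 * (1 - 1 / 4)⁻¹) :=
    (hasSum_geometric_of_lt_one (by norm_num) (by norm_num)).mul_left _
  simp_rw [pow_succ']
  rw [← ENNReal.ofReal_tsum_of_nonneg (fun k => by positivity) hgeom.summable, hgeom.tsum_eq,
    ENNReal.ofReal_lt_one]
  norm_num

lemma not_summable_sigma_of_le_sum {α : ℕ → Type*} [∀ k, Fintype (α k)] {g : (Σ k, α k) → ℝ}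
    {ε : ℝ} (hε : 0 < ε) (hg : ∀ k, ε ≤ ∑ m, g ⟨k, m⟩) : ¬ Summable g := by
  intro hsum
  have hlim : Tendsto (fun k => ∑ m, g ⟨k, m⟩) atTop (nhds 0) := by
    simpa only [tsum_fintype] using hsum.sigma.tendsto_atTop_zero
  exact hε.not_ge (ge_of_tendsto' hlim hg)

end Convergence

section LatticePoint

variable {ι : Type*}

/-- The point of Euclidean space with natural coordinates `p`. The centres of the balls are taken
among these points, so that they are automatically separated. -/
noncomputable def latticePoint (p : ι → ℕ) : EuclideanSpace ℝ ι :=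
  WithLp.toLp 2 fun i => (p i : ℝ)

lemma latticePoint_add (p q : ι → ℕ) :
    latticePoint (p + q) = latticePoint p + latticePoint q := by
  ext i
  simp [latticePoint]

lemma latticePoint_single [DecidableEq ι] (i : ι) (n : ℕ) :
    latticePoint (Pi.single i n) = EuclideanSpace.single i (n : ℝ) := by
  ext j
  simp [latticePoint, Pi.single_apply]

variable [Fintype ι]

lemma apply_le_norm_latticePoint (p : ι → ℕ) (i : ι) : (p i : ℝ) ≤ ‖latticePoint p‖ := by
  simpa [latticePoint] using PiLp.norm_apply_le (latticePoint p) i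

lemma norm_latticePoint_le {p : ι → ℕ} {M : ℕ} (hp : ∀ i, p i ≤ M) :
    ‖latticePoint p‖ ≤ Fintype.card ι * M := by
  have hsum := (EuclideanSpace.basisFun ι ℝ).sum_repr (latticePoint p)
  calc ‖latticePoint p‖ ≤ ∑ i, (p i : ℝ) := by
        conv_lhs => rw [← hsum]
        refine (norm_sum_le _ _).trans_eq ?_
        simp [latticePoint, norm_smul]
    _ ≤ ∑ _i : ι, (M : ℝ) := by
        gcongr with i
        exact hp i
    _ = Fintype.card ι * M := by simp

lemma one_le_norm_latticePoint_sub {p q : ι → ℕ} (hpq : p ≠ q) :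
    1 ≤ ‖latticePoint p - latticePoint q‖ := by
  obtain ⟨i, hi⟩ := Function.ne_iff.1 hpq
  have hint : (1 : ℤ) ≤ |(p i : ℤ) - q i| :=
    Int.one_le_abs (sub_ne_zero.2 (by exact_mod_cast hi))
  calc (1 : ℝ) ≤ |(p i : ℝ) - q i| := by exact_mod_cast hint
    _ ≤ ‖latticePoint p - latticePoint q‖ :=
      PiLp.norm_apply_le (latticePoint p - latticePoint q) i

end LatticePoint

section Cluster

/-- The ratio `(d + 1) * 4 ^ (k + 1)` between the distance to the origin and the side length of the
`k`-th cube of centres: the cube lies in a ball whose radius is `4 ^ (-(k + 1))` times the distance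
from its centre to the origin. -/
def clusterRatio (d k : ℕ) : ℕ :=
  (d + 1) * 4 ^ (k + 1)

lemma clusterRatio_pos (d k : ℕ) : 0 < clusterRatio d k := by
  unfold clusterRatio
  positivity

/-- The common radius `s` of the balls centred in a cube of side length `M` at distance `C * M` from
the origin, chosen such that `(s / (2 * C * M)) ^ (d - 2) = M ^ (-d)`: at distance at most
`2 * C * M`, the `M ^ d` balls of the cube contribute at least `1` to the series. -/
noncomputable def clusterRadius (d C M : ℕ) : ℝ :=
  2 * C * (M : ℝ) ^ (-2 / ((d - 2 : ℕ) : ℝ))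

lemma clusterRadius_pos {C M : ℕ} (d : ℕ) (hC : 0 < C) (hM : 0 < M) : 0 < clusterRadius d C M := by
  unfold clusterRadius
  positivity

lemma clusterRadius_pow {d : ℕ} (hd : 3 ≤ d) (C M : ℕ) :
    clusterRadius d C M ^ (d - 2) = (2 * C) ^ (d - 2) / M ^ 2 := by
  have hd : ((d - 2 : ℕ) : ℝ) ≠ 0 := by
    exact_mod_cast (by omega : d - 2 ≠ 0)
  rw [clusterRadius, mul_pow, ← Real.rpow_mul_natCast M.cast_nonneg, div_mul_cancel₀ _ hd,
    Real.rpow_neg M.cast_nonneg, Real.rpow_two, div_eq_mul_inv]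

lemma tendsto_clusterRadius {d : ℕ} (hd : 3 ≤ d) (C : ℕ) :
    Tendsto (clusterRadius d C) atTop (nhds 0) := by
  have hd : (0 : ℝ) < 2 / (d - 2 : ℕ) := by
    have : 0 < d - 2 := by omega
    positivity
  have hlim := ((tendsto_rpow_neg_atTop hd).comp tendsto_natCast_atTop_atTop).const_mul (2 * C : ℝ)
  rw [mul_zero] at hlim
  refine hlim.congr fun M => ?_
  simp [clusterRadius, neg_div]

lemma clusterRadius_pow_mul_sq_le {d C M : ℕ} (hd : 3 ≤ d) (hM : 0 < M) {x : ℝ} (hx : 0 ≤ x)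
    (hxCM : x ≤ 2 * C * M) : clusterRadius d C M ^ (d - 2) * x ^ 2 ≤ (2 * C : ℝ) ^ d := by
  calc clusterRadius d C M ^ (d - 2) * x ^ 2
      ≤ (2 * C : ℝ) ^ (d - 2) / M ^ 2 * (2 * C * M) ^ 2 := by
        rw [clusterRadius_pow hd]
        gcongr
    _ = (2 * C : ℝ) ^ (d - 2) * (2 * C) ^ 2 := by
        field_simp
    _ = (2 * C : ℝ) ^ d := by
        rw [← pow_add, Nat.sub_add_cancel (by omega)]

lemma inv_pow_le_clusterRadius_div_pow {d C M : ℕ} (hd : 3 ≤ d) (hC : 0 < C) (hM : 0 < M) {x : ℝ}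
    (hx : 0 < x) (hxCM : x ≤ 2 * C * M) :
    (M ^ d : ℝ)⁻¹ ≤ (clusterRadius d C M / x) ^ (d - 2) := by
  calc (M ^ d : ℝ)⁻¹ = ((M : ℝ) ^ (2 + (d - 2)))⁻¹ := by
        rw [Nat.add_sub_cancel' (by omega)]
    _ = (2 * C) ^ (d - 2) / M ^ 2 / (2 * C * M) ^ (d - 2) := by
        rw [pow_add, mul_pow (2 * C : ℝ)]
        field_simp
    _ ≤ (2 * C) ^ (d - 2) / M ^ 2 / x ^ (d - 2) := by gcongr
    _ = (clusterRadius d C M / x) ^ (d - 2) := by rw [div_pow, clusterRadius_pow hd]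

lemma exists_strictMono_sideLength {d : ℕ} (hd : 3 ≤ d) {f : ℝ → ℝ}
    (hf : Tendsto f atTop atTop) :
    ∃ M : ℕ → ℕ, StrictMono M ∧ ∀ k, 0 < M k ∧ clusterRadius d (clusterRatio d k) (M k) ≤ 1 / 4 ∧
      ∀ x, (M k : ℝ) ≤ x → (2 * clusterRatio d k : ℝ) ^ d ≤ f x := by
  refine extraction_forall_of_eventually (P := fun k N => 0 < N ∧
    clusterRadius d (clusterRatio d k) N ≤ 1 / 4 ∧
      ∀ x, (N : ℝ) ≤ x → (2 * clusterRatio d k : ℝ) ^ d ≤ f x) fun k => ?_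
  obtain ⟨a, ha⟩ := eventually_atTop.1 (hf.eventually_ge_atTop ((2 * clusterRatio d k : ℝ) ^ d))
  filter_upwards [eventually_gt_atTop 0, tendsto_natCast_atTop_atTop.eventually_ge_atTop a,
    (tendsto_clusterRadius hd (clusterRatio d k)).eventually_le_const
      (by norm_num : (0 : ℝ) < 1 / 4)]
    with M hM haM hr
  exact ⟨hM, hr, fun x hx => ha x (haM.trans hx)⟩

/-- The corner closest to the origin of the `k`-th cube, which has side length `M k`. -/
noncomputable def clusterCorner (d : ℕ) [NeZero d] (M : ℕ → ℕ) (k : ℕ) :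
    EuclideanSpace ℝ (Fin d) :=
  EuclideanSpace.single 0 (clusterRatio d k * M k : ℝ)

lemma norm_clusterCorner (d : ℕ) [NeZero d] (M : ℕ → ℕ) (k : ℕ) :
    ‖clusterCorner d M k‖ = clusterRatio d k * M k := by
  rw [clusterCorner, PiLp.norm_single, Real.norm_of_nonneg (by positivity)]

variable {d : ℕ} [NeZero d] {M : ℕ → ℕ}

/-- The lattice points of disjoint cubes, the `k`-th of which has side length `M k` and is
translated along the first axis to distance `clusterRatio d k * M k` from the origin. -/
def clusterPoint (M : ℕ → ℕ) (a : Σ k, Fin d → Fin (M k)) : Fin d → ℕ :=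
  (fun i => (a.2 i : ℕ)) + Pi.single 0 (clusterRatio d a.1 * M a.1)

lemma clusterPoint_zero_mem_Ico (hM : Monotone M) (a : Σ k, Fin d → Fin (M k)) :
    clusterPoint M a 0 ∈
      Ico (clusterRatio d a.1 * M a.1) (clusterRatio d (a.1 + 1) * M (a.1 + 1)) := by
  have hratio : clusterRatio d a.1 + 1 ≤ clusterRatio d (a.1 + 1) := by
    have := clusterRatio_pos d a.1
    have : clusterRatio d (a.1 + 1) = 4 * clusterRatio d a.1 := by unfold clusterRatio; ring
    omega
  have hnext : (clusterRatio d a.1 + 1) * M a.1 ≤ clusterRatio d (a.1 + 1) * M (a.1 + 1) :=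
    Nat.mul_le_mul hratio (hM a.1.le_succ)
  have hlt : (a.2 0 : ℕ) < M a.1 := (a.2 0).2
  simp only [clusterPoint, Pi.add_apply, Pi.single_eq_same, mem_Ico]
  constructor <;> linarith

lemma clusterPoint_injective (hM : Monotone M) :
    Function.Injective (clusterPoint M : (Σ k, Fin d → Fin (M k)) → Fin d → ℕ) := by
  have hR : Monotone fun k => clusterRatio d k * M k := fun k l hkl => by
    dsimp only [clusterRatio]
    gcongr
    · norm_num
    · exact hM hkl
  rintro ⟨k, m⟩ ⟨l, n⟩ hab
  obtain rfl : k = l := by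
    by_contra hkl
    refine disjoint_left.1 (hR.pairwise_disjoint_on_Ico_succ hkl)
      (clusterPoint_zero_mem_Ico hM ⟨k, m⟩) ?_
    rw [hab]
    exact clusterPoint_zero_mem_Ico hM ⟨l, n⟩
  congr 1
  ext i
  exact congrFun (add_right_cancel hab) i

lemma le_norm_clusterPoint (a : Σ k, Fin d → Fin (M k)) :
    (clusterRatio d a.1 * M a.1 : ℝ) ≤ ‖latticePoint (clusterPoint M a)‖ := by
  refine le_trans ?_ (apply_le_norm_latticePoint _ 0)
  exact_mod_cast (by simp [clusterPoint] : clusterRatio d a.1 * M a.1 ≤ clusterPoint M a 0)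

lemma sideLength_le_norm_clusterPoint (a : Σ k, Fin d → Fin (M k)) :
    (M a.1 : ℝ) ≤ ‖latticePoint (clusterPoint M a)‖ := by
  refine le_trans ?_ (le_norm_clusterPoint a)
  exact_mod_cast Nat.le_mul_of_pos_left _ (clusterRatio_pos d a.1)

lemma norm_clusterPoint_sub_clusterCorner_le (a : Σ k, Fin d → Fin (M k)) :
    ‖latticePoint (clusterPoint M a) - clusterCorner d M a.1‖ ≤ d * M a.1 := by
  rw [clusterPoint, clusterCorner, latticePoint_add, latticePoint_single, Nat.cast_mul,
    add_sub_cancel_right]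
  simpa using norm_latticePoint_le fun i => (a.2 i).2.le

lemma norm_clusterPoint_le (a : Σ k, Fin d → Fin (M k)) :
    ‖latticePoint (clusterPoint M a)‖ ≤ 2 * clusterRatio d a.1 * M a.1 := by
  have hd : (d : ℝ) ≤ clusterRatio d a.1 := by
    exact_mod_cast d.le_succ.trans (Nat.le_mul_of_pos_right _ (by positivity))
  have hmul : (d : ℝ) * M a.1 ≤ clusterRatio d a.1 * M a.1 := by gcongr
  linarith [norm_clusterCorner d M a.1, norm_clusterPoint_sub_clusterCorner_le a,
    norm_le_norm_sub_add (latticePoint (clusterPoint M a)) (clusterCorner d M a.1)]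

lemma closedBall_clusterPoint_subset_ball (a : Σ k, Fin d → Fin (M k)) {s : ℝ} (hs : s < M a.1) :
    Metric.closedBall (latticePoint (clusterPoint M a)) s ⊆
      Metric.ball (clusterCorner d M a.1) ((d + 1) * M a.1) := by
  refine Metric.closedBall_subset_ball' ?_
  rw [dist_eq_norm]
  linarith [norm_clusterPoint_sub_clusterCorner_le a]

lemma div_norm_clusterCorner {k : ℕ} (hM : 0 < M k) :
    (d + 1) * M k / ‖clusterCorner d M k‖ = (1 / 4 : ℝ) ^ (k + 1) := by
  rw [norm_clusterCorner, clusterRatio]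
  push_cast
  rw [one_div, inv_pow]
  field_simp

lemma isAvoidable_clusterPoint (hd : 3 ≤ d) (hM : ∀ k, 0 < M k)
    {a : ℕ → Σ k, Fin d → Fin (M k)} {r : ℕ → ℝ} (hr : ∀ n, r n < M (a n).1) :
    IsAvoidable.{u} (fun n => latticePoint (clusterPoint M (a n))) r := by
  have hcorner (k) : clusterCorner d M k ≠ 0 := by
    rw [← norm_ne_zero_iff, norm_clusterCorner]
    exact_mod_cast (Nat.mul_pos (clusterRatio_pos d k) (hM k)).ne'
  have hpos (k) : (0 : ℝ) < (d + 1) * M k := by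
    have := hM k
    positivity
  refine isAvoidable_of_tsum_lt_one hd hcorner hpos ?_
    fun n => ⟨(a n).1, closedBall_clusterPoint_subset_ball (a n) (hr n)⟩
  calc ∑' k, ENNReal.ofReal (((d + 1) * M k / ‖clusterCorner d M k‖) ^ (d - 2))
      ≤ ∑' k, ENNReal.ofReal ((1 / 4) ^ (k + 1)) := by
        gcongr with k
        rw [div_norm_clusterCorner (hM k)]
        exact pow_le_of_le_one (by positivity)
          (pow_le_one₀ (by norm_num) (by norm_num)) (by omega)
    _ < 1 := tsum_ofReal_one_div_four_pow_succ_lt_one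

lemma not_summable_clusterRadius_div_norm (hd : 3 ≤ d) (hM : ∀ k, 0 < M k) :
    ¬ Summable fun a : Σ k, Fin d → Fin (M k) =>
      (clusterRadius d (clusterRatio d a.1) (M a.1) / ‖latticePoint (clusterPoint M a)‖) ^
        (d - 2) := by
  refine not_summable_sigma_of_le_sum one_pos fun k => ?_
  have hMk := hM k
  have hC := clusterRatio_pos d k
  calc (1 : ℝ) = ∑ _m : Fin d → Fin (M k), (M k ^ d : ℝ)⁻¹ := by simp [hMk.ne']
    _ ≤ _ := Finset.sum_le_sum fun m _ => inv_pow_le_clusterRadius_div_pow hd hC hMk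
        (lt_of_lt_of_le (by positivity) (le_norm_clusterPoint ⟨k, m⟩)) (norm_clusterPoint_le ⟨k, m⟩)

end Cluster

theorem theorem4_general (d : ℕ) (hd : 3 ≤ d) (f : ℝ → ℝ) (hf : Tendsto f atTop atTop) :
    ∃ (c : ℕ → EuclideanSpace ℝ (Fin d)) (r : ℕ → ℝ),
      IsBallCollection c r ∧ IsSeparatedCollection c ∧ IsAvoidable.{u} c r ∧
      (∀ n, r n ^ (d - 2) * ‖c n‖ ^ 2 ≤ f ‖c n‖) ∧
      Tendsto (fun N : ℕ => ∑ n ∈ Finset.range N, (r n / ‖c n‖) ^ (d - 2)) atTop atTop := by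
  have : NeZero d := ⟨by omega⟩
  obtain ⟨M, hM, hM'⟩ := exists_strictMono_sideLength hd hf
  choose hpos hrad hle using hM'
  have : Infinite (Σ k, Fin d → Fin (M k)) :=
    Infinite.of_surjective Sigma.fst fun k => ⟨⟨k, fun _ => ⟨0, hpos k⟩⟩, rfl⟩
  obtain ⟨e⟩ : Nonempty (ℕ ≃ Σ k, Fin d → Fin (M k)) := nonempty_equiv_of_countable
  let c n := latticePoint (clusterPoint M (e n))
  let r n := clusterRadius d (clusterRatio d (e n).1) (M (e n).1)
  have hone (n) : (1 : ℝ) ≤ M (e n).1 := by exact_mod_cast hpos (e n).1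
  have hr0 (n) : 0 < r n := clusterRadius_pos d (clusterRatio_pos d _) (hpos _)
  have hr (n) : r n ≤ 1 / 4 := hrad _
  have hnorm (n) : (M (e n).1 : ℝ) ≤ ‖c n‖ := sideLength_le_norm_clusterPoint (e n)
  have hsep : ∀ n m, n ≠ m → 1 ≤ ‖c n - c m‖ := fun n m hnm => one_le_norm_latticePoint_sub
    ((clusterPoint_injective hM.monotone).comp e.injective |>.ne hnm)
  refine ⟨c, r, isBallCollection_of_add_lt_norm_sub hr0 (fun n m hnm => ?_) fun n => ?_,
    ⟨1 / 2, by norm_num, by simpa using hsep⟩,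
    isAvoidable_clusterPoint hd hpos fun n => by linarith [hr n, hone n], fun n => ?_, ?_⟩
  · linarith [hr n, hr m, hsep n m hnm]
  · linarith [hr n, hone n, hnorm n]
  · exact (clusterRadius_pow_mul_sq_le hd (hpos _) (norm_nonneg _) (norm_clusterPoint_le _)).trans
      (hle _ _ (hnorm n))
  · rw [← not_summable_iff_tendsto_nat_atTop_of_nonneg fun n =>
      pow_nonneg (div_nonneg (hr0 n).le (norm_nonneg _)) _]
    exact fun h => not_summable_clusterRadius_div_norm hd hpos (e.summable_iff.1 h)

theorem theorem4 (d : ℕ) (hd : 3 ≤ d) (f : ℝ → ℝ) (hf_mono : MonotoneOn f (Ici 0))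
    (hf_unbdd : ¬ BddAbove (f '' Ici 0)) :
    ∃ (c : ℕ → EuclideanSpace ℝ (Fin d)) (r : ℕ → ℝ),
      IsBallCollection c r ∧ IsSeparatedCollection c ∧ IsAvoidable.{u} c r ∧
      (∀ n, r n ^ (d - 2) * ‖c n‖ ^ 2 ≤ f ‖c n‖) ∧
      Tendsto (fun N : ℕ => ∑ n ∈ Finset.range N, (r n / ‖c n‖) ^ (d - 2)) atTop atTop :=
  theorem4_general d hd f (tendsto_atTop_of_monotoneOn_of_not_bddAbove hf_mono hf_unbdd)
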